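/- Let $\{0,1\}^n_m$ denote the set of points of $\{0,1\}^n$ of Hamming weight exactly $m$. For a map $h:[2k]\to[k]$ let $\mathsf{C}_h=\{(y_{h(1)},\dots,y_{h(2k)}) : y\in\{0,1\}^k\}\subseteq\{0,1\}^{2k}$. Call $h$ 2-to-1 if $|h^{-1}(j)|=2$ for every $j\in[k]$; thus, for $h$ chosen uniformly at random among all 2-to-1 maps, $\mathsf{C}=\mathsf{C}_h$ is the random $k$-dimensional subcube obtained by partitioning the $2k$ coordinates into $k$ pairs uniformly at random and identifying the coordinates in each pair. Lemma 5.2. There are absolute constants $\eta>0$ and $A>0$ such that for every even positive integer $k$ and every set $S\subseteq\{0,1\}^{2k}_k$, $$\Pr_{\mathsf{C}}\left[\left|\frac{|S|}{\binom{2k}{k}}-\frac{|S\cap\mathsf{C}|}{\binom{k}{k/2}}\right|\ge\frac{1}{k^{\eta}}\right]\le\frac{A}{k^{\eta}}.$$ -/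

import Mathlib

/-- The Hamming weight of a point of the cube `{0,1}^n`. -/
def weight {n : ℕ} (x : Fin n → Bool) : ℕ :=
  (Finset.univ.filter fun i => x i = true).card

/-- The slice `{0,1}^n_m`: the points of `{0,1}^n` of Hamming weight exactly `m`. -/
def slice (n m : ℕ) : Finset (Fin n → Bool) :=
  Finset.univ.filter fun x => weight x = m

/-- The embedding `y ↦ x(y)` of `{0,1}^k` into `{0,1}^n` given by a base point `a` and a map
`h : [n] → [k]`, namely `x(y)_i = y_{h(i)} ⊕ a_i`. -/
def embed {n k : ℕ} (a : Fin n → Bool) (h : Fin n → Fin k) (y : Fin k → Bool) : Fin n → Bool :=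
  fun i => xor (y (h i)) (a i)

/-- The subcube `C_{a,h} = {x(y) : y ∈ {0,1}^k}` of `{0,1}^n`. -/
def subcube {n k : ℕ} (a : Fin n → Bool) (h : Fin n → Fin k) : Finset (Fin n → Bool) :=
  Finset.univ.image (embed a h)

/-- The set of maps `h : [2k] → [k]` that are 2-to-1: every fibre has exactly two elements, so
that the fibres of `h` partition the `2k` coordinates into `k` pairs. -/
def twoToOneMaps (k : ℕ) : Set (Fin (2 * k) → Fin k) :=
  {h | ∀ j : Fin k, (Finset.univ.filter fun i => h i = j).card = 2}

/-!
The proof bounds the second moment of `|S ∩ C_h| / binom(k, k/2)` over a random 2-to-1 map `h` and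
applies Chebyshev's inequality.

Write `k = 2m`, `Ω` for the middle slice of `{0,1}^{2k}`, `N = binom(2k, k)`, `B = binom(k, m)`.
Summed over `h`, the squared deviations are `⟨1_S, K 1_S⟩ / B²`, where `K` (`covMatrix`) is the
covariance matrix of the events `x ∈ C_h`, `x ∈ Ω`. So it is enough to show that all eigenvalues of
`K` are small, which follows from two facts.

* *Every eigenspace of `K` with nonzero eigenvalue has dimension at least `k`*
  (`le_finrank_eigenspace_covMatrix`). It consists of functions on `Ω` of mean zero and is invariant
  under permutations of the coordinates. A nonzero function of this kind distinguishes two points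
  that differ by a transposition; restricting to the `k + 1` points `z ∪ {j}`, with `z` of weight
  `k - 1` and `j ∉ z`, gives a permutation-invariant space of functions on `k + 1` points
  containing a nonconstant one, which has dimension at least `k`.
* *The Hilbert-Schmidt norm of `K` is small* (`sum_covMatrix_sq_le`, `sum_jointCount_sq`). The number
  of `h` with `x, y ∈ C_h` depends only on the number of coordinates where `x` is one and `y` is
  zero; this number is even, `2d` say, if the count is nonzero, and double counting gives the value.
  Up to the square of the number of maps, the sum of squares is `(B²/N) ∑_d r_d²` with
  `r_d = binom(m, d)² / binom(2m, 2d)`. As `r_d` is a ratio of central binomial coefficients,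
  `∑_d r_d²` is `O(log k)`.

If `c` is an eigenvalue of multiplicity at least `k`, then `k c²` is at most the squared
Hilbert-Schmidt norm (`finrank_mul_sq_le_sum_sq`). This makes the variance
`O(((√k log k) / k)^{1/2})`, hence `O(k^{-3/16})`, and Chebyshev's inequality allows `η = 1/16`.
-/

open Finset hiding slice

/-! ### Eigenvalues of high multiplicity -/

/-- An eigenvalue contributes its square times its multiplicity to the squared Hilbert-Schmidt norm:
Bessel's inequality for each row of `K` against an orthonormal basis of the eigenspace. -/
theorem finrank_mul_sq_le_sum_sq {Q : Type*} [Fintype Q] [DecidableEq Q] {K : Matrix Q Q ℝ} (c : ℝ) :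
    (Module.finrank ℝ (Module.End.eigenspace (Matrix.toLin' K) c)) * c ^ 2
      ≤ ∑ x, ∑ y, K x y ^ 2 := by
  set W := (Module.End.eigenspace (Matrix.toLin' K) c).map
    (WithLp.linearEquiv 2 ℝ (Q → ℝ)).symm.toLinearMap with hW
  have hfin : Module.finrank ℝ W =
      Module.finrank ℝ (Module.End.eigenspace (Matrix.toLin' K) c) :=
    LinearEquiv.finrank_map_eq _ _
  let b := stdOrthonormalBasis ℝ W
  have hon : Orthonormal ℝ (fun i => (b i : EuclideanSpace ℝ Q)) :=
    b.orthonormal.comp_linearIsometry W.subtypeₗᵢ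
  have hb : ∀ i x, ∑ y, K x y * (b i : EuclideanSpace ℝ Q) y
      = c * (b i : EuclideanSpace ℝ Q) x := by
    intro i x
    obtain ⟨g, hg, hgb⟩ := (b i).2
    rw [← hgb]
    have h := congrFun (Module.End.mem_eigenspace_iff.1 hg) x
    simpa [Matrix.mulVec, dotProduct] using h
  have hrow : ∀ x, ∑ i, (c * (b i : EuclideanSpace ℝ Q) x) ^ 2 ≤ ∑ y, K x y ^ 2 := by
    intro x
    have h := hon.sum_inner_products_le (WithLp.toLp 2 (K x)) (s := univ)
    rw [EuclideanSpace.norm_sq_eq] at h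
    simp only [Real.norm_eq_abs, sq_abs] at h
    refine le_trans (le_of_eq ?_) h
    refine sum_congr rfl fun i _ => ?_
    rw [← hb]
    simp [PiLp.inner_apply]
  calc _ = ∑ i, c ^ 2 * ‖(b i : EuclideanSpace ℝ Q)‖ ^ 2 := by
        simp [hon.1, hfin]
    _ = ∑ i, ∑ x, (c * (b i : EuclideanSpace ℝ Q) x) ^ 2 := by
        refine sum_congr rfl fun i _ => ?_
        rw [EuclideanSpace.norm_sq_eq, mul_sum]
        simp [mul_pow]
    _ = ∑ x, ∑ i, (c * (b i : EuclideanSpace ℝ Q) x) ^ 2 := sum_comm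
    _ ≤ _ := sum_le_sum fun x _ => hrow x

/-- If every nonzero eigenvalue has multiplicity at least `N`, the quadratic form is bounded by the
Hilbert-Schmidt norm divided by `√N`. -/
theorem dotProduct_mulVec_le_of_eigenspace_finrank {Q : Type*} [Fintype Q] [DecidableEq Q]
    {K : Matrix Q Q ℝ} (hK : K.IsHermitian) {N : ℕ} (hN : 0 < N)
    (hdim : ∀ c : ℝ, c ≠ 0 → Module.End.eigenspace (Matrix.toLin' K) c ≠ ⊥ →
      N ≤ Module.finrank ℝ (Module.End.eigenspace (Matrix.toLin' K) c)) (f : Q → ℝ) :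
    f ⬝ᵥ K.mulVec f ≤ √((∑ x, ∑ y, K x y ^ 2) / N) * ∑ x, f x ^ 2 := by
  have hev : ∀ i, hK.eigenvalues i ≤ √((∑ x, ∑ y, K x y ^ 2) / N) := by
    intro i
    rcases le_or_gt (hK.eigenvalues i) 0 with h0 | h0
    · exact h0.trans (Real.sqrt_nonneg _)
    refine Real.le_sqrt_of_sq_le ?_
    rw [le_div_iff₀ (by positivity), mul_comm]
    refine le_trans ?_ (finrank_mul_sq_le_sum_sq (hK.eigenvalues i))
    gcongr
    refine hdim _ h0.ne' ?_
    rw [Submodule.ne_bot_iff]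
    refine ⟨(hK.eigenvectorBasis i).ofLp, ?_, ?_⟩
    · rw [Module.End.mem_eigenspace_iff, Matrix.toLin'_apply, hK.mulVec_eigenvectorBasis]
    · intro h
      have := hK.eigenvectorBasis.orthonormal.ne_zero i
      exact this (by ext x; exact congrFun h x)
  set F : EuclideanSpace ℝ Q := WithLp.toLp 2 f
  set TF : EuclideanSpace ℝ Q := WithLp.toLp 2 (K.mulVec f)
  have h1 : f ⬝ᵥ K.mulVec f = ∑ i, hK.eigenvalues i * inner ℝ (hK.eigenvectorBasis i) F ^ 2 := by
    have h2 : f ⬝ᵥ K.mulVec f = inner ℝ F TF := by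
      simp [F, TF, PiLp.inner_apply, dotProduct, mul_comm]
    rw [h2, ← hK.eigenvectorBasis.sum_inner_mul_inner]
    refine sum_congr rfl fun i _ => ?_
    have h3 : inner ℝ (hK.eigenvectorBasis i) TF
        = hK.eigenvalues i * inner ℝ (hK.eigenvectorBasis i) F := by
      have h4 : inner ℝ (hK.eigenvectorBasis i) TF
          = (hK.eigenvectorBasis i).ofLp ⬝ᵥ K.mulVec f := by
        simp [TF, PiLp.inner_apply, dotProduct, mul_comm]
      have h5 : inner ℝ (hK.eigenvectorBasis i) F = (hK.eigenvectorBasis i).ofLp ⬝ᵥ f := by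
        simp [F, PiLp.inner_apply, dotProduct, mul_comm]
      have hT : K.transpose = K := by simpa [Matrix.IsHermitian] using hK
      rw [h4, h5, Matrix.dotProduct_mulVec, ← Matrix.mulVec_transpose, hT,
        hK.mulVec_eigenvectorBasis, smul_dotProduct, smul_eq_mul]
    rw [h3, real_inner_comm]
    ring
  have h6 : ∑ x, f x ^ 2 = ∑ i, inner ℝ (hK.eigenvectorBasis i) F ^ 2 := by
    have := hK.eigenvectorBasis.sum_sq_norm_inner_right F
    rw [EuclideanSpace.norm_sq_eq] at this
    simpa [F] using this.symm
  rw [h1, h6, mul_sum]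
  exact sum_le_sum fun i _ => mul_le_mul_of_nonneg_right (hev i) (sq_nonneg _)

/-- A permutation-invariant space of functions on `J` that contains a nonconstant function contains
all differences of point masses. -/
theorem card_le_finrank_add_one_of_swap_invariant {J : Type*} [Fintype J] [DecidableEq J]
    (R : Submodule ℝ (J → ℝ)) (hR : ∀ g ∈ R, ∀ i j, g ∘ Equiv.swap i j ∈ R)
    {g : J → ℝ} (hg : g ∈ R) {a b : J} (hab : g a ≠ g b) :
    Fintype.card J ≤ Module.finrank ℝ R + 1 := by
  have hne : a ≠ b := fun h => hab (by rw [h])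
  -- `g` minus its transposition is a multiple of `e_b - e_a`
  have hba : (Pi.single b 1 - Pi.single a 1 : J → ℝ) ∈ R := by
    have h1 : (g b - g a)⁻¹ • (g - g ∘ Equiv.swap a b) ∈ R :=
      R.smul_mem _ (R.sub_mem hg (hR g hg a b))
    convert h1 using 1
    have h2 : g b - g a ≠ 0 := sub_ne_zero.2 hab.symm
    funext x
    by_cases hxa : x = a
    · subst hxa
      simp [hne]
      field_simp
      ring
    by_cases hxb : x = b
    · subst hxb
      simp [hne.symm]
      field_simp
    · simp [hxa, hxb, Equiv.swap_apply_of_ne_of_ne hxa hxb]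
  have hall : ∀ j : {j // j ≠ a}, (Pi.single j.1 1 - Pi.single a 1 : J → ℝ) ∈ R := by
    intro ⟨j, hj⟩
    convert hR _ hba b j using 1
    funext x
    simp only [Pi.sub_apply, Function.comp_apply, Pi.single_apply, Equiv.swap_apply_def]
    grind
  -- the differences `e_j - e_a` with `j ≠ a` are linearly independent: evaluate away from `a`
  have hli : LinearIndependent ℝ
      (fun j : {j // j ≠ a} => (⟨_, hall j⟩ : R)) := by
    rw [Fintype.linearIndependent_iff]
    intro c hc i
    have h := congrFun (congrArg Subtype.val hc) i.1
    have hi := i.2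
    simp [Finset.sum_apply, Pi.single_apply, hi] at h
    simpa [Subtype.val_inj] using h
  have := hli.fintype_card_le_finrank
  rw [Fintype.card_subtype_compl, Fintype.card_subtype_eq] at this
  omega

/-! ### Pairs of points of a slice -/

/-- Two functions whose fibres have equal sizes differ by a permutation of the domain. -/
theorem exists_perm_comp_eq {α β : Type*} [Fintype α] [DecidableEq α] [DecidableEq β] (f g : α → β)
    (h : ∀ b, #{i | f i = b} = #{i | g i = b}) : ∃ σ : Equiv.Perm α, f ∘ σ = g := by
  have e : ∀ b, Nonempty ({i // g i = b} ≃ {i // f i = b}) := by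
    intro b
    refine Fintype.card_eq.1 ?_
    rw [Fintype.card_subtype, Fintype.card_subtype, h b]
  exact ⟨Equiv.ofFiberEquiv (fun b => (e b).some), funext fun a => Equiv.ofFiberEquiv_map _ a⟩

theorem weight_comp_perm {n : ℕ} (x : Fin n → Bool) (σ : Equiv.Perm (Fin n)) :
    weight (x ∘ σ) = weight x := by
  refine card_equiv σ fun i => by simp

theorem mem_slice_iff {n m : ℕ} {x : Fin n → Bool} : x ∈ slice n m ↔ #{i | x i = true} = m :=
  mem_filter_univ x

theorem comp_perm_mem_slice {n m : ℕ} {x : Fin n → Bool} (σ : Equiv.Perm (Fin n)) :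
    x ∘ σ ∈ slice n m ↔ x ∈ slice n m := by
  simp [slice, weight_comp_perm]

theorem weight_add_card_false {n : ℕ} (x : Fin n → Bool) :
    weight x + #{i | x i = false} = n := by
  have h := card_filter_add_card_filter_not (s := (univ : Finset (Fin n))) (fun i => x i = true)
  simpa [weight] using h

theorem card_slice (n m : ℕ) : #(slice n m) = n.choose m := by
  have h : #(powersetCard m (univ : Finset (Fin n))) = n.choose m := by simp
  rw [← h]
  refine card_nbij' (fun x => univ.filter fun i => x i = true) (fun A i => decide (i ∈ A))
    ?_ ?_ ?_ ?_
  · intro x hx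
    simpa [mem_slice_iff, mem_powersetCard] using hx
  · intro A hA
    simpa [mem_slice_iff, mem_powersetCard] using hA
  · intro x _
    funext i
    simp
  · intro A _
    ext i
    simp

theorem exists_perm_of_mem_slice {n m : ℕ} {x y : Fin n → Bool} (hx : x ∈ slice n m)
    (hy : y ∈ slice n m) : ∃ σ : Equiv.Perm (Fin n), x ∘ σ = y := by
  refine exists_perm_comp_eq x y fun b => ?_
  have h1 := weight_add_card_false x
  have h2 := weight_add_card_false y
  simp only [slice, mem_filter_univ] at hx hy
  cases b
  · omega
  · exact hx.trans hy.symm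

/-- The number of coordinates at which `x` is one and `y` is zero. -/
def dropCount {n : ℕ} (x y : Fin n → Bool) : ℕ :=
  #{i | x i = true ∧ y i = false}

/-- For two points of a slice, the number of drops determines how often each of the four pairs of
values occurs. -/
theorem card_pair_fibres {n m s : ℕ} {x y : Fin n → Bool} (hx : x ∈ slice n m)
    (hy : y ∈ slice n m) (hs : dropCount x y = s) :
    #{i | x i = true ∧ y i = true} + s = m ∧ #{i | x i = false ∧ y i = true} = s ∧
      #{i | x i = false ∧ y i = false} + m + s = n := by
  have h1 := weight_add_card_false x
  simp only [slice, mem_filter_univ] at hx hy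
  have h2 := card_filter_add_card_filter_not (s := (univ.filter fun i => x i = true))
    (fun i => y i = true)
  have h3 := card_filter_add_card_filter_not (s := (univ.filter fun i => y i = true))
    (fun i => x i = true)
  have h4 := card_filter_add_card_filter_not (s := (univ.filter fun i => x i = false))
    (fun i => y i = true)
  simp only [filter_filter, Bool.not_eq_true] at h2 h3 h4
  have h5 : #{i | y i = true ∧ x i = true} = #{i | x i = true ∧ y i = true} := by
    simp only [and_comm]
  have h6 : #{i | y i = true ∧ x i = false} = #{i | x i = false ∧ y i = true} := by
    simp only [and_comm]
  simp only [weight, dropCount] at *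
  omega

/-- Permutations of the coordinates act transitively on the pairs of points of a slice with a given
number of drops. -/
theorem exists_perm_of_dropCount_eq {n m : ℕ} {x y x' y' : Fin n → Bool} (hx : x ∈ slice n m)
    (hy : y ∈ slice n m) (hx' : x' ∈ slice n m) (hy' : y' ∈ slice n m)
    (h : dropCount x y = dropCount x' y') :
    ∃ σ : Equiv.Perm (Fin n), x ∘ σ = x' ∧ y ∘ σ = y' := by
  obtain ⟨h1, h2, h3⟩ := card_pair_fibres hx hy rfl
  obtain ⟨h4, h5, h6⟩ := card_pair_fibres hx' hy' rfl
  obtain ⟨σ, hσ⟩ := exists_perm_comp_eq (fun i => (x i, y i)) (fun i => (x' i, y' i)) (by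
    rintro ⟨b, c⟩
    simp only [Prod.mk.injEq]
    rcases b <;> rcases c <;> simp only [dropCount] at * <;> omega)
  exact ⟨σ, funext fun i => congrArg Prod.fst (congrFun hσ i),
    funext fun i => congrArg Prod.snd (congrFun hσ i)⟩

/-- A point `y` of the slice with `s` drops from `x` is given by the `s` ones of `x` that it turns off
and the `s` zeros of `x` that it turns on. -/
theorem card_filter_dropCount_eq {n m : ℕ} {x : Fin n → Bool} (hx : x ∈ slice n m) (s : ℕ) :
    #{y ∈ slice n m | dropCount x y = s} = m.choose s * (n - m).choose s := by
  have h0 : #{i | x i = false} = n - m := by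
    have := weight_add_card_false x
    simp only [slice, mem_filter_univ] at hx
    omega
  have hw : #{i | x i = true} = m := mem_slice_iff.1 hx
  rw [← h0, ← hw, ← card_powersetCard, ← card_powersetCard, ← card_product, hw]
  refine card_nbij' (fun y => (univ.filter fun i => x i = true ∧ y i = false,
      univ.filter fun i => x i = false ∧ y i = true))
    (fun P i => if x i then decide (i ∉ P.1) else decide (i ∈ P.2)) ?_ ?_ ?_ ?_
  · intro y hy
    simp only [coe_filter, Set.mem_ofPred_eq] at hy
    obtain ⟨h1, h2, h3⟩ := card_pair_fibres hx hy.1 hy.2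
    simp only [mem_coe, mem_product, mem_powersetCard]
    refine ⟨⟨fun i => ?_, hy.2⟩, ⟨fun i => ?_, h2⟩⟩ <;> simp +contextual
  · rintro ⟨P, R⟩ hPR
    simp only [mem_coe, mem_product, mem_powersetCard] at hPR
    obtain ⟨⟨hP, hPs⟩, hR, hRs⟩ := hPR
    have hPx : ∀ i ∈ P, x i = true := fun i hi => by simpa using hP hi
    have hRx : ∀ i ∈ R, x i = false := fun i hi => by simpa using hR hi
    have hd : dropCount x (fun i => if x i then decide (i ∉ P) else decide (i ∈ R)) = s := by
      rw [← hPs, dropCount]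
      congr 1
      ext i
      simp only [mem_filter_univ]
      have := hPx i
      grind
    have hs : weight (fun i => if x i then decide (i ∉ P) else decide (i ∈ R)) = m := by
      have h1 : (univ.filter fun i => (if x i then decide (i ∉ P) else decide (i ∈ R)) = true)
          = ((univ.filter fun i => x i = true) \ P) ∪ R := by
        ext i
        have := hPx i
        have := hRx i
        simp only [mem_filter_univ, mem_union, mem_sdiff]
        grind
      have h2 : Disjoint ((univ.filter fun i => x i = true) \ P) R := by
        rw [disjoint_left]
        intro i hi hi'
        have := hRx i hi'
        simp [this] at hi
      have h3 := card_le_card hP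
      rw [weight, h1, card_union_of_disjoint h2, card_sdiff_of_subset hP, hw, hPs, hRs]
      omega
    simp only [coe_filter, Set.mem_ofPred_eq]
    exact ⟨by simpa [slice] using hs, hd⟩
  · intro y hy
    funext i
    by_cases hxi : x i = true <;> simp [hxi]
  · rintro ⟨P, R⟩ hPR
    simp only [mem_coe, mem_product, mem_powersetCard] at hPR
    obtain ⟨⟨hP, hPs⟩, hR, hRs⟩ := hPR
    have hPx : ∀ i ∈ P, x i = true := fun i hi => by simpa using hP hi
    have hRx : ∀ i ∈ R, x i = false := fun i hi => by simpa using hR hi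
    ext i
    · have := hPx i
      simp only [mem_filter_univ]
      grind
    · have := hRx i
      simp only [mem_filter_univ]
      grind

theorem card_filter_product_dropCount_eq (n m s : ℕ) :
    #{p ∈ slice n m ×ˢ slice n m | dropCount p.1 p.2 = s}
      = n.choose m * (m.choose s * (n - m).choose s) := by
  rw [card_filter, sum_product]
  simp_rw [← card_filter]
  rw [sum_congr rfl fun x hx => card_filter_dropCount_eq hx s, sum_const, card_slice, smul_eq_mul]

/-! ### Permutation-invariant spaces of functions on a slice -/

/-- A nonzero permutation-invariant space of mean-zero functions supported on the slice has dimension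
at least `n - m`. -/
theorem le_finrank_of_swap_invariant {n m : ℕ} (W : Submodule ℝ ((Fin n → Bool) → ℝ))
    (hsupp : ∀ f ∈ W, ∀ x ∉ slice n m, f x = 0)
    (hsum : ∀ f ∈ W, ∑ x, f x = 0)
    (hinv : ∀ f ∈ W, ∀ i j, (fun x => f (x ∘ Equiv.swap i j)) ∈ W)
    (hW : W ≠ ⊥) : n - m ≤ Module.finrank ℝ W := by
  obtain ⟨f, hf, hf0⟩ := (Submodule.ne_bot_iff W).1 hW
  -- a mean-zero function on the slice cannot be invariant under all transpositions
  have hex : ∃ i j x, f (x ∘ Equiv.swap i j) ≠ f x := by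
    by_contra! hcon
    have hperm : ∀ (σ : Equiv.Perm (Fin n)) x, f (x ∘ σ) = f x := by
      intro σ
      induction σ using Equiv.Perm.swap_induction_on' with
      | one => intro x; rfl
      | mul_swap σ i j _ ih =>
        intro x
        rw [Equiv.Perm.coe_mul, ← Function.comp_assoc, hcon, ih]
    obtain ⟨u, hu⟩ := Function.ne_iff.1 hf0
    have hus : u ∈ slice n m := by
      by_contra h
      exact hu (hsupp f hf u h)
    have hconst : ∀ x ∈ slice n m, f x = f u := by
      intro x hx
      obtain ⟨σ, rfl⟩ := exists_perm_of_mem_slice hus hx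
      exact hperm σ u
    have h1 := hsum f hf
    rw [← sum_subset (subset_univ (slice n m)) (fun x _ hx => hsupp f hf x hx),
      sum_congr rfl hconst, sum_const, nsmul_eq_mul, mul_eq_zero] at h1
    rcases h1 with h1 | h1
    · have : 0 < #(slice n m) := card_pos.2 ⟨u, hus⟩
      exact this.ne' (by exact_mod_cast h1)
    · exact hu h1
  have hex2 : ∃ a b x, x a = true ∧ x b = false ∧ f (x ∘ Equiv.swap a b) ≠ f x := by
    obtain ⟨i, j, x, hx⟩ := hex
    by_cases hij : x i = x j
    · exfalso
      apply hx
      congr 1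
      funext l
      simp only [Function.comp_apply, Equiv.swap_apply_def]
      grind
    · cases hi : x i
      · have hj : x j = true := by grind
        exact ⟨j, i, x, hj, hi, by rwa [Equiv.swap_comm]⟩
      · have hj : x j = false := by grind
        exact ⟨i, j, x, hi, hj, hx⟩
  obtain ⟨a, b, x, hxa, hxb, hne⟩ := hex2
  have hab : a ≠ b := fun h => by rw [h, hxb] at hxa; simp at hxa
  have hxs : x ∈ slice n m := by
    by_contra h
    refine hne ?_
    rw [hsupp f hf x h, hsupp f hf _ fun h' => h ((comp_perm_mem_slice _).1 h')]
  -- restrict to the points obtained by moving the one of `x` at `a` to a zero of `x`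
  let z := Function.update x a false
  let pt : {i // z i = false} → (Fin n → Bool) := fun j => Function.update z j.1 true
  have hpt : ∀ i j l : {i // z i = false},
      pt l ∘ Equiv.swap i.1 j.1 = pt (Equiv.swap i j l) := by
    intro i j l
    funext t
    simp only [pt, Function.comp_apply, Function.update_apply, Equiv.swap_apply_def]
    grind
  let Φ : ((Fin n → Bool) → ℝ) →ₗ[ℝ] ({i // z i = false} → ℝ) := LinearMap.funLeft ℝ ℝ pt
  have hza : z a = false := by simp [z]
  have hzb : z b = false := by simp [z, Function.update_apply, hxb]
  have hpa : pt ⟨a, hza⟩ = x := by simp [pt, z, ← hxa]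
  have hpb : pt ⟨b, hzb⟩ = x ∘ Equiv.swap a b := by
    have := hpt ⟨a, hza⟩ ⟨b, hzb⟩ ⟨a, hza⟩
    rw [hpa, Equiv.swap_apply_left] at this
    exact this.symm
  have hcard := card_le_finrank_add_one_of_swap_invariant (W.map Φ) (by
      rintro _ ⟨g, hg, rfl⟩ i j
      refine ⟨_, hinv g hg i.1 j.1, ?_⟩
      funext l
      exact congrArg g (hpt i j l))
    (Submodule.mem_map_of_mem (f := Φ) hf) (a := ⟨b, hzb⟩) (b := ⟨a, hza⟩) (by
      change f (pt _) ≠ f (pt _)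
      rwa [hpa, hpb])
  have hfin := Submodule.finrank_map_le Φ W
  have hJ : Fintype.card {i // z i = false} = n - m + 1 := by
    rw [Fintype.card_subtype]
    have h1 : (univ.filter fun i => z i = false) = insert a (univ.filter fun i => x i = false) := by
      ext i
      simp only [mem_filter_univ, mem_insert, z, Function.update_apply]
      grind
    have := weight_add_card_false x
    simp only [slice, mem_filter_univ] at hxs
    rw [h1, card_insert_of_notMem (by simp [hxa])]
    omega
  omega

/-! ### Subcubes of 2-to-1 maps -/

theorem mem_subcube_zero_iff {n k : ℕ} {h : Fin n → Fin k} {x : Fin n → Bool} :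
    x ∈ subcube (fun _ => false) h ↔ ∃ y : Fin k → Bool, y ∘ h = x := by
  have : ∀ y : Fin k → Bool, embed (fun _ => false) h y = y ∘ h := by
    intro y
    funext i
    simp [embed]
  simp [subcube, this]

theorem comp_perm_mem_subcube {n k : ℕ} {h : Fin n → Fin k} {x : Fin n → Bool}
    (σ : Equiv.Perm (Fin n)) :
    x ∘ σ ∈ subcube (fun _ => false) (h ∘ σ) ↔ x ∈ subcube (fun _ => false) h := by
  simp only [mem_subcube_zero_iff, ← Function.comp_assoc, σ.surjective.injective_comp_right.eq_iff]

/-- The finset of 2-to-1 maps `[2k] → [k]`. -/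
def twoToOneFinset (k : ℕ) : Finset (Fin (2 * k) → Fin k) :=
  univ.filter fun h => ∀ j : Fin k, #{i | h i = j} = 2

theorem coe_twoToOneFinset (k : ℕ) : (twoToOneFinset k : Set _) = twoToOneMaps k := by
  ext h
  simp [twoToOneFinset, twoToOneMaps]

theorem comp_perm_mem_twoToOneFinset {k : ℕ} {h : Fin (2 * k) → Fin k}
    (σ : Equiv.Perm (Fin (2 * k))) : h ∘ σ ∈ twoToOneFinset k ↔ h ∈ twoToOneFinset k := by
  simp only [twoToOneFinset, mem_filter_univ]
  refine forall_congr' fun j => ?_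
  have : #{i | (h ∘ σ) i = j} = #{i | h i = j} := card_equiv σ fun i => by simp
  rw [this]

theorem card_filter_comp_of_mem_twoToOneFinset {k : ℕ} {h : Fin (2 * k) → Fin k}
    (hh : h ∈ twoToOneFinset k) (p : Fin k → Prop) [DecidablePred p] :
    #{i | p (h i)} = 2 * #{j | p j} := by
  simp only [twoToOneFinset, mem_filter_univ] at hh
  rw [card_eq_sum_card_fiberwise (f := h) (t := univ.filter p) (fun i hi => by simpa using hi),
    sum_const_nat (m := 2), mul_comm]
  intro j hj
  rw [mem_filter_univ] at hj
  refine Eq.trans ?_ (hh j)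
  rw [filter_filter]
  congr 1
  ext i
  simp only [mem_filter_univ, and_iff_right_iff_imp]
  rintro rfl
  exact hj

theorem surjective_of_mem_twoToOneFinset {k : ℕ} {h : Fin (2 * k) → Fin k}
    (hh : h ∈ twoToOneFinset k) : Function.Surjective h := by
  intro j
  simp only [twoToOneFinset, mem_filter_univ] at hh
  obtain ⟨i, hi⟩ := card_pos.1 (show 0 < #{i | h i = j} by rw [hh j]; norm_num)
  exact ⟨i, by simpa using hi⟩

theorem comp_mem_slice_iff {m : ℕ} {h : Fin (2 * (2 * m)) → Fin (2 * m)}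
    (hh : h ∈ twoToOneFinset (2 * m)) (y : Fin (2 * m) → Bool) :
    y ∘ h ∈ slice (2 * (2 * m)) (2 * m) ↔ y ∈ slice (2 * m) m := by
  rw [mem_slice_iff, mem_slice_iff]
  have := card_filter_comp_of_mem_twoToOneFinset hh (fun j => y j = true)
  simp only [Function.comp_apply]
  omega

theorem dropCount_comp {k : ℕ} {h : Fin (2 * k) → Fin k} (hh : h ∈ twoToOneFinset k)
    (y z : Fin k → Bool) : dropCount (y ∘ h) (z ∘ h) = 2 * dropCount y z :=
  card_filter_comp_of_mem_twoToOneFinset hh (fun j => y j = true ∧ z j = false)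

/-- The number of 2-to-1 maps whose subcube contains both `x` and `y`. -/
def jointCount {k : ℕ} (x y : Fin (2 * k) → Bool) : ℕ :=
  #{h ∈ twoToOneFinset k | x ∈ subcube (fun _ => false) h ∧ y ∈ subcube (fun _ => false) h}

theorem jointCount_comp_perm {k : ℕ} (x y : Fin (2 * k) → Bool) (σ : Equiv.Perm (Fin (2 * k))) :
    jointCount (x ∘ σ) (y ∘ σ) = jointCount x y := by
  refine (card_equiv (σ.symm.arrowCongr (Equiv.refl (Fin k))) fun h => ?_).symm
  have : σ.symm.arrowCongr (Equiv.refl (Fin k)) h = h ∘ σ := by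
    funext i
    simp [Equiv.arrowCongr]
  rw [this, mem_filter, mem_filter, comp_perm_mem_twoToOneFinset, comp_perm_mem_subcube,
    comp_perm_mem_subcube]

/-- Double counting of triples `(h, x, y)` with `x` and `y` in the middle slice and in `C_h`: the pairs
of points of `C_h` are parametrized by pairs of points of the middle slice of `{0,1}^{2m}`, and
the number of drops doubles. -/
theorem sum_mul_jointCount (m : ℕ) (φ : ℕ → ℝ) :
    ∑ p ∈ slice (2 * (2 * m)) (2 * m) ×ˢ slice (2 * (2 * m)) (2 * m),
        φ (dropCount p.1 p.2) * jointCount p.1 p.2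
      = #(twoToOneFinset (2 * m)) *
        ∑ p ∈ slice (2 * m) m ×ˢ slice (2 * m) m, φ (2 * dropCount p.1 p.2) := by
  simp_rw [jointCount, card_filter, Nat.cast_sum, mul_sum]
  rw [sum_comm, ← mul_sum, ← nsmul_eq_mul, ← sum_const]
  refine sum_congr rfl fun h hh => ?_
  simp_rw [Nat.cast_ite, Nat.cast_one, Nat.cast_zero, mul_ite, mul_one, mul_zero]
  rw [← sum_filter]
  symm
  have hinj := (surjective_of_mem_twoToOneFinset hh).injective_comp_right (γ := Bool)
  refine sum_nbij (fun p => (p.1 ∘ h, p.2 ∘ h)) ?_ ?_ ?_ ?_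
  · intro p hp
    rw [mem_product] at hp
    rw [mem_filter, mem_product, comp_mem_slice_iff hh, comp_mem_slice_iff hh]
    exact ⟨hp, mem_subcube_zero_iff.2 ⟨_, rfl⟩, mem_subcube_zero_iff.2 ⟨_, rfl⟩⟩
  · intro p _ q _ hpq
    exact Prod.ext (hinj (congrArg Prod.fst hpq)) (hinj (congrArg Prod.snd hpq))
  · rintro ⟨x, y⟩ hp
    rw [mem_coe, mem_filter, mem_product] at hp
    obtain ⟨⟨hx, hy⟩, hcx, hcy⟩ := hp
    obtain ⟨u, rfl⟩ := mem_subcube_zero_iff.1 hcx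
    obtain ⟨v, rfl⟩ := mem_subcube_zero_iff.1 hcy
    rw [comp_mem_slice_iff hh] at hx hy
    exact ⟨(u, v), by simpa using ⟨hx, hy⟩, rfl⟩
  · intro p _
    rw [dropCount_comp hh]

/-- The value of `jointCount`, from `sum_mul_jointCount` and the fact that `jointCount` is constant on
pairs with a given number of drops. -/
theorem jointCount_mul_choose {m : ℕ} {x y : Fin (2 * (2 * m)) → Bool}
    (hx : x ∈ slice (2 * (2 * m)) (2 * m)) (hy : y ∈ slice (2 * (2 * m)) (2 * m)) {d : ℕ}
    (hd : dropCount x y = 2 * d) :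
    (jointCount x y : ℝ) * ((2 * (2 * m)).choose (2 * m) * (2 * m).choose (2 * d) ^ 2)
      = #(twoToOneFinset (2 * m)) * ((2 * m).choose m * m.choose d ^ 2) := by
  have h := sum_mul_jointCount m (fun s => if s = 2 * d then 1 else 0)
  simp only [ite_mul, one_mul, zero_mul] at h
  rw [← sum_filter, ← sum_filter, sum_const, sum_congr rfl (g := fun _ => (jointCount x y : ℝ)),
    sum_const] at h
  · have h1 := card_filter_product_dropCount_eq (2 * (2 * m)) (2 * m) (2 * d)
    have h2 := card_filter_product_dropCount_eq (2 * m) m d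
    have h3 : 2 * (2 * m) - 2 * m = 2 * m := by omega
    have h4 : 2 * m - m = m := by omega
    rw [h3] at h1
    rw [h4] at h2
    have h5 : ∀ p : (Fin (2 * m) → Bool) × (Fin (2 * m) → Bool),
        2 * dropCount p.1 p.2 = 2 * d ↔ dropCount p.1 p.2 = d := fun p => by omega
    simp only [h5, h1, h2, nsmul_eq_mul, mul_one] at h
    push_cast at h
    linear_combination h
  · intro p hp
    rw [mem_filter, mem_product] at hp
    obtain ⟨σ, h1, h2⟩ := exists_perm_of_dropCount_eq hx hy hp.1.1 hp.1.2 (hd.trans hp.2.symm)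
    rw [← h1, ← h2, jointCount_comp_perm]

theorem dropCount_self {n : ℕ} (x : Fin n → Bool) : dropCount x x = 0 := by
  simp [dropCount]

theorem jointCount_self_mul_choose {m : ℕ} {x : Fin (2 * (2 * m)) → Bool}
    (hx : x ∈ slice (2 * (2 * m)) (2 * m)) :
    (jointCount x x : ℝ) * (2 * (2 * m)).choose (2 * m)
      = #(twoToOneFinset (2 * m)) * (2 * m).choose m := by
  have := jointCount_mul_choose hx hx (d := 0) (dropCount_self x)
  simpa using this

theorem sum_jointCount_sq (m : ℕ) :
    ∑ p ∈ slice (2 * (2 * m)) (2 * m) ×ˢ slice (2 * (2 * m)) (2 * m),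
        (jointCount p.1 p.2 : ℝ) ^ 2
      = (#(twoToOneFinset (2 * m)) : ℝ) ^ 2 * ∑ d ∈ range (m + 1),
        (((2 * m).choose m : ℝ) * m.choose d ^ 2) ^ 2 /
          ((2 * (2 * m)).choose (2 * m) * (2 * m).choose (2 * d) ^ 2) := by
  set H : ℝ := ((#(twoToOneFinset (2 * m)) : ℕ) : ℝ)
  let φ : ℕ → ℝ := fun s => H * ((2 * m).choose m * m.choose (s / 2) ^ 2) /
          ((2 * (2 * m)).choose (2 * m) * (2 * m).choose s ^ 2)
  have hNpos : (0 : ℝ) < (2 * (2 * m)).choose (2 * m) := by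
    exact_mod_cast Nat.choose_pos (by omega)
  have hle : ∀ {n l : ℕ} {x y : Fin n → Bool}, x ∈ slice n l → dropCount x y ≤ l := by
    intro n l x y hx
    rw [← mem_slice_iff.1 hx]
    exact card_le_card fun i hi => by simp at hi ⊢; exact hi.1
  have h1 : ∀ p ∈ slice (2 * (2 * m)) (2 * m) ×ˢ slice (2 * (2 * m)) (2 * m),
      (jointCount p.1 p.2 : ℝ) ^ 2 = φ (dropCount p.1 p.2) * jointCount p.1 p.2 := by
    intro p hp
    rw [mem_product] at hp
    rcases Nat.eq_zero_or_pos (jointCount p.1 p.2) with h0 | h0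
    · simp [h0]
    -- the points lie in a common subcube, so the number of drops is even
    obtain ⟨h, hh⟩ := card_pos.1 h0
    rw [mem_filter] at hh
    obtain ⟨u, hu⟩ := mem_subcube_zero_iff.1 hh.2.1
    obtain ⟨v, hv⟩ := mem_subcube_zero_iff.1 hh.2.2
    have hd : dropCount p.1 p.2 = 2 * dropCount u v := by rw [← hu, ← hv, dropCount_comp hh.1]
    have hj := jointCount_mul_choose hp.1 hp.2 hd
    have hpos : (0 : ℝ) < (2 * m).choose (2 * dropCount u v) := by
      exact_mod_cast Nat.choose_pos (by rw [← hd]; exact hle hp.1)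
    have hφ : φ (dropCount p.1 p.2) = jointCount p.1 p.2 := by
      simp only [φ, hd, Nat.mul_div_cancel_left _ (zero_lt_two)]
      rw [div_eq_iff (by positivity), hj]
    rw [hφ, sq]
  rw [sum_congr rfl h1, sum_mul_jointCount,
    ← sum_fiberwise_of_maps_to (t := range (m + 1)) (g := fun p => dropCount p.1 p.2), sq, mul_assoc]
  · congr 1
    rw [mul_sum _ _ H]
    refine sum_congr rfl fun d hd => ?_
    rw [sum_congr rfl (g := fun _ => φ (2 * d)) (fun p hp => by rw [(mem_filter.1 hp).2]), sum_const,
      card_filter_product_dropCount_eq,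
      show 2 * m - m = m by omega]
    simp only [φ, Nat.mul_div_cancel_left _ (zero_lt_two), nsmul_eq_mul]
    push_cast
    ring
  · intro p hp
    rw [mem_product] at hp
    exact mem_range.2 (Nat.lt_succ_of_le (hle hp.1))

/-! ### Central binomial coefficients -/

theorem centralBinom_sq_mul_le (n : ℕ) : (n.centralBinom : ℝ) ^ 2 * (2 * n + 1) ≤ 16 ^ n := by
  induction n with
  | zero => simp
  | succ n ih =>
    have h : ((n + 1 : ℕ) : ℝ) * (n + 1).centralBinom = 2 * (2 * n + 1) * n.centralBinom := by
      exact_mod_cast Nat.succ_mul_centralBinom_succ n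
    push_cast at h ⊢
    have h1 : ((n + 1).centralBinom : ℝ) = 2 * (2 * n + 1) * n.centralBinom / (n + 1) := by
      field_simp
      linarith
    rw [h1]
    calc _ = ((n.centralBinom : ℝ) ^ 2 * (2 * n + 1)) *
          (4 * (2 * n + 1) * (2 * n + 3) / (n + 1) ^ 2) := by field_simp; ring
      _ ≤ 16 ^ n * 16 := by
        gcongr
        rw [div_le_iff₀ (by positivity)]
        nlinarith
      _ = _ := by ring

theorem sixteen_pow_le_mul_centralBinom_sq {n : ℕ} (hn : 0 < n) :
    (16 : ℝ) ^ n ≤ (n.centralBinom : ℝ) ^ 2 * (4 * n) := by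
  induction n, hn using Nat.le_induction with
  | base => simp [Nat.centralBinom, Nat.choose]; norm_num
  | succ n hn ih =>
    have hn' : (0 : ℝ) < n := by exact_mod_cast hn
    have h : ((n + 1 : ℕ) : ℝ) * (n + 1).centralBinom = 2 * (2 * n + 1) * n.centralBinom := by
      exact_mod_cast Nat.succ_mul_centralBinom_succ n
    push_cast at h ⊢
    have h1 : ((n + 1).centralBinom : ℝ) = 2 * (2 * n + 1) * n.centralBinom / (n + 1) := by
      field_simp
      linarith
    rw [h1]
    calc (16 : ℝ) ^ (n + 1) = 16 ^ n * 16 := by ring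
      _ ≤ ((n.centralBinom : ℝ) ^ 2 * (4 * n)) * (4 * (2 * n + 1) ^ 2 / (n * (n + 1))) := by
        gcongr
        rw [le_div_iff₀ (by positivity)]
        nlinarith
      _ = _ := by field_simp; ring

/-- `binom(m, d)² / binom(2m, 2d)` as a ratio of central binomial coefficients. -/
theorem centralBinom_mul_choose_sq {m d : ℕ} (hd : d ≤ m) :
    (m.centralBinom : ℝ) * m.choose d ^ 2
      = (2 * m).choose (2 * d) * (d.centralBinom * (m - d).centralBinom) := by
  have h1 : 2 * m - 2 * d = 2 * (m - d) := by omega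
  have h2 : ∀ n : ℕ, 2 * n - n = n := fun n => by omega
  simp only [Nat.centralBinom]
  rw [Nat.cast_choose ℝ hd, Nat.cast_choose ℝ (show m ≤ 2 * m by omega),
    Nat.cast_choose ℝ (show 2 * d ≤ 2 * m by omega), Nat.cast_choose ℝ (show d ≤ 2 * d by omega),
    Nat.cast_choose ℝ (show m - d ≤ 2 * (m - d) by omega), h1, h2, h2, h2]
  have := fun n : ℕ => (Nat.cast_ne_zero (R := ℝ)).2 n.factorial_ne_zero
  field_simp [this]

/-- A logarithmic bound, relaxed to a small power of `n`. -/
theorem sum_range_one_div_le {n : ℕ} (hn : 1 ≤ n) :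
    ∑ d ∈ range n, (1 : ℝ) / (2 * d + 1) ≤ 9 * (n : ℝ) ^ (1 / 8 : ℝ) := by
  have h1 : ∑ d ∈ range n, (1 : ℝ) / (2 * d + 1) ≤ harmonic n := by
    rw [harmonic]
    push_cast
    refine sum_le_sum fun d _ => ?_
    rw [one_div]
    gcongr
    linarith [(Nat.cast_nonneg d : (0 : ℝ) ≤ d)]
  have h2 := harmonic_le_one_add_log n
  have h3 : Real.log n ≤ (n : ℝ) ^ (1 / 8 : ℝ) / (1 / 8) :=
    Real.log_le_rpow_div (by positivity) (by norm_num)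
  have h4 : (1 : ℝ) ≤ (n : ℝ) ^ (1 / 8 : ℝ) :=
    Real.one_le_rpow (by exact_mod_cast hn) (by norm_num)
  linarith

theorem centralBinom_mul_div_sq_le {m d : ℕ} (hm : 0 < m) (hd : d ≤ m) :
    ((d.centralBinom : ℝ) * (m - d).centralBinom / m.centralBinom) ^ 2
      ≤ 2 * (1 / (2 * (d : ℝ) + 1) + 1 / (2 * ((m - d : ℕ) : ℝ) + 1)) := by
  have h1 := centralBinom_sq_mul_le d
  have h2 := centralBinom_sq_mul_le (m - d)
  have h3 := sixteen_pow_le_mul_centralBinom_sq hm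
  have hpos : (0 : ℝ) < m.centralBinom := by exact_mod_cast m.centralBinom_pos
  rw [← le_div_iff₀ (by positivity)] at h1 h2
  have hpow : (16 : ℝ) ^ d * 16 ^ (m - d) = 16 ^ m := by
    rw [← pow_add, Nat.add_sub_cancel' hd]
  have hmd : (d : ℝ) + ((m - d : ℕ) : ℝ) = m := by
    rw [← Nat.cast_add, Nat.add_sub_cancel' hd]
  have hm' : (0 : ℝ) < m := by exact_mod_cast hm
  calc _ = (d.centralBinom : ℝ) ^ 2 * ((m - d).centralBinom : ℝ) ^ 2 / m.centralBinom ^ 2 := by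
        ring
    _ ≤ 16 ^ d / (2 * d + 1) * (16 ^ (m - d) / (2 * ((m - d : ℕ) : ℝ) + 1))
          / m.centralBinom ^ 2 := by
        gcongr
    _ = 16 ^ m / m.centralBinom ^ 2 / ((2 * d + 1) * (2 * ((m - d : ℕ) : ℝ) + 1)) := by
        rw [← hpow]
        field_simp
    _ ≤ 4 * m / ((2 * d + 1) * (2 * ((m - d : ℕ) : ℝ) + 1)) := by
        gcongr
        rw [div_le_iff₀ (by positivity)]
        linarith
    -- `4 * m + 4` is twice the sum of the two factors of the denominator
    _ ≤ (4 * m + 4) / ((2 * d + 1) * (2 * ((m - d : ℕ) : ℝ) + 1)) := by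
        gcongr
        linarith
    _ = _ := by
        rw [← hmd]
        field_simp
        ring

/-- With `k = 2m`, the factor in front is at most `2√k` and the sum is at most `36 k^{1/8}`. -/
theorem choose_div_mul_sum_le {m : ℕ} (hm : 0 < m) :
    ((2 * m).centralBinom : ℝ) / m.centralBinom ^ 2 * ∑ d ∈ range (m + 1),
      ((d.centralBinom : ℝ) * (m - d).centralBinom / m.centralBinom) ^ 2
      ≤ 72 * ((2 * m : ℕ) : ℝ) ^ (5 / 8 : ℝ) := by
  have hpos : (0 : ℝ) < m.centralBinom := by exact_mod_cast m.centralBinom_pos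
  have hm1 : (1 : ℝ) ≤ m := by exact_mod_cast hm
  have h1 : ((2 * m).centralBinom : ℝ) / m.centralBinom ^ 2
      ≤ 2 * ((2 * m : ℕ) : ℝ) ^ (1 / 2 : ℝ) := by
    have h2 := centralBinom_sq_mul_le (2 * m)
    have h3 := sixteen_pow_le_mul_centralBinom_sq hm
    have h4 : (16 : ℝ) ^ (2 * m) ≤ ((m.centralBinom : ℝ) ^ 2 * (4 * m)) ^ 2 := by
      rw [mul_comm 2 m, pow_mul]
      gcongr
    rw [← Real.sqrt_eq_rpow, div_le_iff₀ (by positivity)]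
    refine abs_le_of_sq_le_sq' ?_ (by positivity) |>.2
    rw [mul_pow, mul_pow, Real.sq_sqrt (by positivity)]
    push_cast at h2 ⊢
    have h5 : ((2 * m).centralBinom : ℝ) ^ 2 * (4 * m)
        ≤ (m.centralBinom ^ 2) ^ 2 * (4 * m) * (4 * m) := by
      nlinarith [sq_nonneg ((2 * m).centralBinom : ℝ)]
    have h6 := le_of_mul_le_mul_right h5 (by positivity)
    nlinarith [sq_nonneg ((m.centralBinom : ℝ) ^ 2)]
  have h2 : ∑ d ∈ range (m + 1),
      ((d.centralBinom : ℝ) * (m - d).centralBinom / m.centralBinom) ^ 2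
      ≤ 36 * ((2 * m : ℕ) : ℝ) ^ (1 / 8 : ℝ) := by
    refine (sum_le_sum fun d hd =>
      centralBinom_mul_div_sq_le hm (Nat.lt_succ_iff.1 (mem_range.1 hd))).trans ?_
    have h3 := sum_range_reflect (fun d : ℕ => (1 : ℝ) / (2 * (d : ℝ) + 1)) (m + 1)
    simp only [Nat.add_sub_cancel_right] at h3
    rw [← mul_sum, sum_add_distrib, h3]
    have h4 := sum_range_one_div_le (show 1 ≤ m + 1 by omega)
    have h5 : ((m + 1 : ℕ) : ℝ) ^ (1 / 8 : ℝ) ≤ ((2 * m : ℕ) : ℝ) ^ (1 / 8 : ℝ) := by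
      gcongr
      omega
    linarith
  calc _ ≤ (2 * ((2 * m : ℕ) : ℝ) ^ (1 / 2 : ℝ)) * (36 * ((2 * m : ℕ) : ℝ) ^ (1 / 8 : ℝ)) := by
        gcongr
    _ = 72 * (((2 * m : ℕ) : ℝ) ^ (1 / 2 : ℝ) * ((2 * m : ℕ) : ℝ) ^ (1 / 8 : ℝ)) := by ring
    _ = _ := by
        rw [← Real.rpow_add (by positivity)]
        norm_num

/-! ### The covariance matrix and the variance -/

theorem card_slice_inter_subcube {m : ℕ} {h : Fin (2 * (2 * m)) → Fin (2 * m)}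
    (hh : h ∈ twoToOneFinset (2 * m)) :
    #(slice (2 * (2 * m)) (2 * m) ∩ subcube (fun _ => false) h) = (2 * m).choose m := by
  rw [← card_slice]
  symm
  refine card_nbij (fun y => y ∘ h) ?_ ?_ ?_
  · intro y hy
    rw [mem_coe, mem_inter, comp_mem_slice_iff hh]
    exact ⟨hy, mem_subcube_zero_iff.2 ⟨y, rfl⟩⟩
  · exact (surjective_of_mem_twoToOneFinset hh).injective_comp_right.injOn
  · intro x hx
    rw [mem_coe, mem_inter] at hx
    obtain ⟨y, rfl⟩ := mem_subcube_zero_iff.1 hx.2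
    exact ⟨y, (comp_mem_slice_iff hh y).1 hx.1, rfl⟩

/-- The indicator of the subcube of `h` on the middle slice, minus its mean there; it is extended
by zero to the whole cube. -/
noncomputable def centredIndicator (m : ℕ) (h : Fin (2 * (2 * m)) → Fin (2 * m))
    (x : Fin (2 * (2 * m)) → Bool) : ℝ :=
  if x ∈ slice (2 * (2 * m)) (2 * m) then
    (if x ∈ subcube (fun _ => false) h then 1 else 0)
      - ((2 * m).choose m : ℝ) / (2 * (2 * m)).choose (2 * m)
  else 0

/-- The covariance matrix of the events `x ∈ C_h`, summed (not averaged) over all 2-to-1 maps. -/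
noncomputable def covMatrix (m : ℕ) :
    Matrix (Fin (2 * (2 * m)) → Bool) (Fin (2 * (2 * m)) → Bool) ℝ :=
  Matrix.of fun x y =>
    ∑ h ∈ twoToOneFinset (2 * m), centredIndicator m h x * centredIndicator m h y

theorem sum_mul_centredIndicator {m : ℕ} {S : Finset (Fin (2 * (2 * m)) → Bool)}
    (hS : S ⊆ slice (2 * (2 * m)) (2 * m)) (h : Fin (2 * (2 * m)) → Fin (2 * m)) :
    ∑ x, (if x ∈ S then 1 else 0) * centredIndicator m h x
      = #(S ∩ subcube (fun _ => false) h)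
        - #S * (((2 * m).choose m : ℝ) / (2 * (2 * m)).choose (2 * m)) := by
  simp only [ite_mul, one_mul, zero_mul]
  rw [← sum_filter, filter_mem_eq_inter, univ_inter,
    sum_congr rfl (fun x hx => by rw [centredIndicator, if_pos (hS hx)]), sum_sub_distrib, ← sum_filter, filter_mem_eq_inter]
  simp

theorem sum_centredIndicator {m : ℕ} {h : Fin (2 * (2 * m)) → Fin (2 * m)}
    (hh : h ∈ twoToOneFinset (2 * m)) : ∑ x, centredIndicator m h x = 0 := by
  have h1 := sum_mul_centredIndicator (m := m) (subset_refl _) h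
  have hN : ((2 * (2 * m)).choose (2 * m) : ℝ) ≠ 0 := by
    exact_mod_cast (Nat.choose_pos (by omega)).ne'
  rw [card_slice_inter_subcube hh, card_slice, mul_div_cancel₀ _ hN, sub_self] at h1
  rw [← h1]
  refine sum_congr rfl fun x _ => ?_
  by_cases hx : x ∈ slice (2 * (2 * m)) (2 * m)
  · simp [hx]
  · simp [hx, centredIndicator]

theorem covMatrix_apply_of_mem {m : ℕ} {x y : Fin (2 * (2 * m)) → Bool}
    (hx : x ∈ slice (2 * (2 * m)) (2 * m)) (hy : y ∈ slice (2 * (2 * m)) (2 * m)) :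
    covMatrix m x y = jointCount x y - #(twoToOneFinset (2 * m)) *
      (((2 * m).choose m : ℝ) / (2 * (2 * m)).choose (2 * m)) ^ 2 := by
  have hN : ((2 * (2 * m)).choose (2 * m) : ℝ) ≠ 0 := by
    exact_mod_cast (Nat.choose_pos (by omega)).ne'
  have hself : ∀ z ∈ slice (2 * (2 * m)) (2 * m), (jointCount z z : ℝ) =
      #(twoToOneFinset (2 * m)) * (((2 * m).choose m : ℝ) / (2 * (2 * m)).choose (2 * m)) := by
    intro z hz
    rw [← mul_div_assoc, eq_div_iff hN, jointCount_self_mul_choose hz]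
  have hx1 := hself x hx
  have hy1 := hself y hy
  simp only [covMatrix, Matrix.of_apply, centredIndicator, hx, hy, if_true]
  generalize ((2 * m).choose m : ℝ) / (2 * (2 * m)).choose (2 * m) = t at *
  simp only [jointCount, and_self, card_filter, Nat.cast_sum] at hx1 hy1 ⊢
  have hH : (#(twoToOneFinset (2 * m)) : ℝ) * t ^ 2
      = ∑ h ∈ twoToOneFinset (2 * m), t ^ 2 := by simp
  have key : ∑ h ∈ twoToOneFinset (2 * m),
      ((if x ∈ subcube (fun _ => false) h then 1 else 0) - t) *
        ((if y ∈ subcube (fun _ => false) h then 1 else 0) - t)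
      = ∑ h ∈ twoToOneFinset (2 * m), ((if x ∈ subcube (fun _ => false) h ∧
          y ∈ subcube (fun _ => false) h then 1 else 0 : ℕ) : ℝ)
        - t * ∑ h ∈ twoToOneFinset (2 * m), ((if x ∈ subcube (fun _ => false) h
          then 1 else 0 : ℕ) : ℝ)
        - t * ∑ h ∈ twoToOneFinset (2 * m), ((if y ∈ subcube (fun _ => false) h
          then 1 else 0 : ℕ) : ℝ)
        + #(twoToOneFinset (2 * m)) * t ^ 2 := by
    rw [hH, mul_sum, mul_sum, ← sum_sub_distrib, ← sum_sub_distrib, ← sum_add_distrib]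
    refine sum_congr rfl fun h _ => ?_
    by_cases h1 : x ∈ subcube (fun _ => false) h <;> by_cases h2 : y ∈ subcube (fun _ => false) h
      <;> simp [h1, h2] <;> ring
  rw [key, hx1, hy1]
  ring

theorem covMatrix_apply_of_notMem {m : ℕ} {x y : Fin (2 * (2 * m)) → Bool}
    (h : ¬(x ∈ slice (2 * (2 * m)) (2 * m) ∧ y ∈ slice (2 * (2 * m)) (2 * m))) :
    covMatrix m x y = 0 := by
  refine sum_eq_zero fun g _ => ?_
  rw [not_and_or] at h
  rcases h with h | h <;> simp [centredIndicator, h]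

theorem covMatrix_comp_perm {m : ℕ} (x y : Fin (2 * (2 * m)) → Bool)
    (σ : Equiv.Perm (Fin (2 * (2 * m)))) :
    covMatrix m (x ∘ σ) (y ∘ σ) = covMatrix m x y := by
  by_cases h : x ∈ slice (2 * (2 * m)) (2 * m) ∧ y ∈ slice (2 * (2 * m)) (2 * m)
  · rw [covMatrix_apply_of_mem h.1 h.2, covMatrix_apply_of_mem ((comp_perm_mem_slice σ).2 h.1)
      ((comp_perm_mem_slice σ).2 h.2), jointCount_comp_perm]
  · rw [covMatrix_apply_of_notMem h, covMatrix_apply_of_notMem]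
    rwa [comp_perm_mem_slice, comp_perm_mem_slice]

theorem covMatrix_isHermitian (m : ℕ) : (covMatrix m).IsHermitian := by
  ext x y
  simp [covMatrix, mul_comm]

theorem sum_covMatrix (m : ℕ) (y : Fin (2 * (2 * m)) → Bool) : ∑ x, covMatrix m x y = 0 := by
  simp only [covMatrix, Matrix.of_apply]
  rw [sum_comm]
  refine sum_eq_zero fun h hh => ?_
  rw [← sum_mul, sum_centredIndicator hh, zero_mul]

/-- On the slice the covariance is `jointCount` minus its mean, so centring only decreases the sum of
squares. -/
theorem sum_covMatrix_sq_le (m : ℕ) :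
    ∑ x, ∑ y, covMatrix m x y ^ 2
      ≤ ∑ p ∈ slice (2 * (2 * m)) (2 * m) ×ˢ slice (2 * (2 * m)) (2 * m),
        (jointCount p.1 p.2 : ℝ) ^ 2 := by
  have hN : ((2 * (2 * m)).choose (2 * m) : ℝ) ≠ 0 := by
    exact_mod_cast (Nat.choose_pos (by omega)).ne'
  set H : ℝ := ((#(twoToOneFinset (2 * m)) : ℕ) : ℝ) with hH
  set c : ℝ := H * (((2 * m).choose m : ℝ) / (2 * (2 * m)).choose (2 * m)) ^ 2 with hc
  have h1 : ∑ p ∈ slice (2 * (2 * m)) (2 * m) ×ˢ slice (2 * (2 * m)) (2 * m),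
      (jointCount p.1 p.2 : ℝ) = ((2 * (2 * m)).choose (2 * m) : ℝ) ^ 2 * c := by
    have := sum_mul_jointCount m (fun _ => 1)
    simp only [one_mul, sum_const, card_product, card_slice, nsmul_eq_mul, mul_one] at this
    rw [this, hc, ← hH]
    push_cast
    field_simp
  have h2 : ∑ x, ∑ y, covMatrix m x y ^ 2
      = ∑ p ∈ slice (2 * (2 * m)) (2 * m) ×ˢ slice (2 * (2 * m)) (2 * m),
        ((jointCount p.1 p.2 : ℝ) - c) ^ 2 := by
    rw [← Fintype.sum_prod_type' (f := fun x y => covMatrix m x y ^ 2),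
      ← sum_subset (subset_univ (slice (2 * (2 * m)) (2 * m) ×ˢ slice (2 * (2 * m)) (2 * m)))]
    · refine sum_congr rfl fun p hp => ?_
      rw [mem_product] at hp
      rw [covMatrix_apply_of_mem hp.1 hp.2]
    · intro p _ hp
      rw [mem_product] at hp
      rw [covMatrix_apply_of_notMem hp]
      norm_num
  have h3 : ∑ p ∈ slice (2 * (2 * m)) (2 * m) ×ˢ slice (2 * (2 * m)) (2 * m),
        ((jointCount p.1 p.2 : ℝ) - c) ^ 2
      = ∑ p ∈ slice (2 * (2 * m)) (2 * m) ×ˢ slice (2 * (2 * m)) (2 * m),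
          (jointCount p.1 p.2 : ℝ) ^ 2
        - 2 * c * ∑ p ∈ slice (2 * (2 * m)) (2 * m) ×ˢ slice (2 * (2 * m)) (2 * m),
          (jointCount p.1 p.2 : ℝ)
        + ((2 * (2 * m)).choose (2 * m) : ℝ) ^ 2 * c ^ 2 := by
    have h4 : ((2 * (2 * m)).choose (2 * m) : ℝ) ^ 2 * c ^ 2
        = ∑ p ∈ slice (2 * (2 * m)) (2 * m) ×ˢ slice (2 * (2 * m)) (2 * m), c ^ 2 := by
      rw [sum_const, card_product, card_slice, nsmul_eq_mul]
      push_cast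
      ring
    rw [h4, mul_sum, ← sum_sub_distrib, ← sum_add_distrib]
    exact sum_congr rfl fun p _ => by ring
  rw [h2, h3, h1]
  nlinarith [sq_nonneg (((2 * (2 * m)).choose (2 * m) : ℝ) * c)]

theorem le_finrank_eigenspace_covMatrix (m : ℕ) {c : ℝ} (hc : c ≠ 0)
    (h : Module.End.eigenspace (Matrix.toLin' (covMatrix m)) c ≠ ⊥) :
    2 * m ≤ Module.finrank ℝ (Module.End.eigenspace (Matrix.toLin' (covMatrix m)) c) := by
  have hev : ∀ f : (Fin (2 * (2 * m)) → Bool) → ℝ,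
      f ∈ Module.End.eigenspace (Matrix.toLin' (covMatrix m)) c ↔
        ∀ x, ∑ y, covMatrix m x y * f y = c * f x := by
    intro f
    rw [Module.End.mem_eigenspace_iff, funext_iff]
    rfl
  have := le_finrank_of_swap_invariant (n := 2 * (2 * m)) (m := 2 * m)
    (Module.End.eigenspace (Matrix.toLin' (covMatrix m)) c) ?_ ?_ ?_ h
  · omega
  · intro f hf x hx
    have h1 := (hev f).1 hf x
    rw [sum_eq_zero fun y _ => by rw [covMatrix_apply_of_notMem (fun h => hx h.1), zero_mul]] at h1
    simpa [hc] using h1.symm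
  · intro f hf
    have h1 : c * ∑ x, f x = 0 := by
      rw [mul_sum, ← sum_congr rfl fun x _ => (hev f).1 hf x, sum_comm]
      refine sum_eq_zero fun y _ => ?_
      rw [← sum_mul, sum_covMatrix, zero_mul]
    simpa [hc] using h1
  · intro f hf i j
    rw [hev] at hf ⊢
    intro x
    rw [← hf]
    refine Fintype.sum_equiv ((Equiv.swap i j).arrowCongr (Equiv.refl Bool)) _ _ fun y => ?_
    have : (Equiv.swap i j).arrowCongr (Equiv.refl Bool) y = y ∘ Equiv.swap i j := by
      funext l
      simp [Equiv.arrowCongr]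
    rw [this, covMatrix_comp_perm]

/-- The second-moment bound: the variance of `|S ∩ C_h| / binom(2m, m)`, summed over all 2-to-1
maps. -/
theorem sum_sq_sub_le {m : ℕ} (hm : 0 < m) {S : Finset (Fin (2 * (2 * m)) → Bool)}
    (hS : S ⊆ slice (2 * (2 * m)) (2 * m)) :
    ∑ h ∈ twoToOneFinset (2 * m), ((#S : ℝ) / (2 * (2 * m)).choose (2 * m)
        - (#(S ∩ subcube (fun _ => false) h) : ℝ) / (2 * m).choose m) ^ 2
      ≤ #(twoToOneFinset (2 * m)) * (9 * ((2 * m : ℕ) : ℝ) ^ (-(3 / 16) : ℝ)) := by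
  have hN : (0 : ℝ) < (2 * (2 * m)).choose (2 * m) := by
    exact_mod_cast Nat.choose_pos (by omega)
  have hB : (0 : ℝ) < (2 * m).choose m := by exact_mod_cast Nat.choose_pos (by omega)
  have hk : (0 : ℝ) < ((2 * m : ℕ) : ℝ) := by exact_mod_cast (by omega : 0 < 2 * m)
  set H : ℝ := ((#(twoToOneFinset (2 * m)) : ℕ) : ℝ) with hH
  set N : ℝ := (((2 * (2 * m)).choose (2 * m) : ℕ) : ℝ) with hNdef
  set B : ℝ := (((2 * m).choose m : ℕ) : ℝ) with hBdef
  set R : ℝ := ∑ d ∈ range (m + 1),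
      ((d.centralBinom : ℝ) * (m - d).centralBinom / m.centralBinom) ^ 2 with hR
  have hSN : (#S : ℝ) ≤ N := by
    rw [hNdef, ← card_slice]
    exact_mod_cast card_le_card hS
  let f : (Fin (2 * (2 * m)) → Bool) → ℝ := fun x => if x ∈ S then 1 else 0
  have hvar : ∑ h ∈ twoToOneFinset (2 * m), ((#S : ℝ) / N
        - (#(S ∩ subcube (fun _ => false) h) : ℝ) / B) ^ 2
      = f ⬝ᵥ (covMatrix m).mulVec f / B ^ 2 := by
    have h1 : f ⬝ᵥ (covMatrix m).mulVec f
        = ∑ h ∈ twoToOneFinset (2 * m), (∑ x, f x * centredIndicator m h x) ^ 2 := by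
      simp only [dotProduct, Matrix.mulVec, covMatrix, Matrix.of_apply, sq, sum_mul, mul_sum]
      rw [sum_comm' (t' := univ) (s' := fun _ => univ) (by simp)]
      rw [sum_congr rfl fun x _ => sum_comm]
      rw [sum_comm]
      refine sum_congr rfl fun h _ => ?_
      refine sum_congr rfl fun x _ => sum_congr rfl fun y _ => ?_
      ring
    rw [h1, sum_div]
    refine sum_congr rfl fun h _ => ?_
    rw [sum_mul_centredIndicator hS, ← hBdef, ← hNdef]
    field_simp
    ring
  have hf2 : ∑ x, f x ^ 2 = #S := by
    simp [f]
  have hHS : ∑ x, ∑ y, covMatrix m x y ^ 2 ≤ H ^ 2 * (B ^ 2 / N * R) := by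
    refine (sum_covMatrix_sq_le m).trans (le_of_eq ?_)
    rw [sum_jointCount_sq, ← hH, ← hBdef, ← hNdef, hR, mul_sum (range (m + 1)) _ (B ^ 2 / N)]
    congr 1
    refine sum_congr rfl fun d hd => ?_
    have hd' : d ≤ m := Nat.lt_succ_iff.1 (mem_range.1 hd)
    have hpos : (0 : ℝ) < (2 * m).choose (2 * d) := by
      exact_mod_cast Nat.choose_pos (by omega)
    have h1 := centralBinom_mul_choose_sq hd'
    have h2 : (m.centralBinom : ℝ) = B := by rw [Nat.centralBinom]
    rw [h2] at h1 ⊢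
    rw [h1]
    field_simp
  have hquad := dotProduct_mulVec_le_of_eigenspace_finrank (covMatrix_isHermitian m)
    (show 0 < 2 * m by omega) (fun c hc h => le_finrank_eigenspace_covMatrix m hc h) f
  rw [hf2] at hquad
  have hnum : N / B ^ 2 * R ≤ 72 * ((2 * m : ℕ) : ℝ) ^ (5 / 8 : ℝ) := by
    exact choose_div_mul_sum_le hm
  rw [hvar, div_le_iff₀ (by positivity)]
  refine hquad.trans ?_
  have hR0 : 0 ≤ R := sum_nonneg fun d _ => sq_nonneg _
  calc √((∑ x, ∑ y, covMatrix m x y ^ 2) / ((2 * m : ℕ) : ℝ)) * #S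
      ≤ √(H ^ 2 * (B ^ 2 / N * R) / ((2 * m : ℕ) : ℝ)) * N := by gcongr
    _ = √((H * B ^ 2) ^ 2 * (N / B ^ 2 * R / ((2 * m : ℕ) : ℝ))) := by
        rw [← Real.sqrt_sq hN.le, ← Real.sqrt_mul (by positivity), Real.sqrt_sq hN.le]
        congr 1
        field_simp
    _ = H * B ^ 2 * √(N / B ^ 2 * R / ((2 * m : ℕ) : ℝ)) := by
        rw [Real.sqrt_mul (by positivity), Real.sqrt_sq (by positivity)]
    _ ≤ H * B ^ 2 * (9 * ((2 * m : ℕ) : ℝ) ^ (-(3 / 16) : ℝ)) := by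
        gcongr
        rw [Real.sqrt_le_left (by positivity), div_le_iff₀ hk]
        refine hnum.trans ?_
        have h1 : ((2 * m : ℕ) : ℝ) ^ (5 / 8 : ℝ)
            = (((2 * m : ℕ) : ℝ) ^ (-(3 / 16) : ℝ)) ^ 2 * ((2 * m : ℕ) : ℝ) := by
          rw [← Real.rpow_natCast, ← Real.rpow_mul hk.le, ← Real.rpow_add_one hk.ne']
          norm_num
        rw [h1, mul_pow]
        have : 0 ≤ (((2 * m : ℕ) : ℝ) ^ (-(3 / 16) : ℝ)) ^ 2 * ((2 * m : ℕ) : ℝ) := by positivity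
        linarith
    _ = _ := by ring

theorem lemma5p2 :
    ∃ η : ℝ, 0 < η ∧ ∃ A : ℝ, 0 < A ∧
      ∀ k : ℕ, 0 < k → Even k → ∀ S : Finset (Fin (2 * k) → Bool), S ⊆ slice (2 * k) k →
        (ProbabilityTheory.uniformOn (twoToOneMaps k)).real
            {h : Fin (2 * k) → Fin k |
              1 / (k : ℝ) ^ η ≤
                |(S.card : ℝ) / ((2 * k).choose k : ℝ)
                  - ((S ∩ subcube (fun _ => false) h).card : ℝ) / (k.choose (k / 2) : ℝ)|}
          ≤ A / (k : ℝ) ^ η := by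
  refine ⟨1 / 16, by norm_num, 9, by norm_num, ?_⟩
  intro k hk hke S hS
  obtain ⟨m, rfl⟩ := hke.exists_two_nsmul
  simp only [smul_eq_mul] at *
  have hm : 0 < m := by omega
  rw [Nat.mul_div_cancel_left m zero_lt_two]
  have hvar := sum_sq_sub_le hm hS
  have hkr : (0 : ℝ) < ((2 * m : ℕ) : ℝ) := by exact_mod_cast hk
  set X : (Fin (2 * (2 * m)) → Fin (2 * m)) → ℝ := fun h =>
    (#S : ℝ) / (2 * (2 * m)).choose (2 * m)
        - (#(S ∩ subcube (fun _ => false) h) : ℝ) / (2 * m).choose m with hX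
  set δ : ℝ := 1 / ((2 * m : ℕ) : ℝ) ^ (1 / 16 : ℝ) with hδ
  have hδ0 : 0 < δ := by positivity
  have hmeas : (ProbabilityTheory.uniformOn (twoToOneMaps (2 * m))).real {h | δ ≤ |X h|}
      = (#{h ∈ twoToOneFinset (2 * m) | δ ≤ |X h|} : ℝ) / #(twoToOneFinset (2 * m)) := by
    have h1 : {h | δ ≤ |X h|} = ((univ.filter fun h => δ ≤ |X h| : Finset _) : Set _) := by
      ext; simp
    rw [MeasureTheory.Measure.real, ← coe_twoToOneFinset, h1,
      ProbabilityTheory.uniformOn_apply_finset, ENNReal.toReal_div, inter_filter, inter_univ]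
    simp
  -- Chebyshev's inequality
  have hcheb : (#{h ∈ twoToOneFinset (2 * m) | δ ≤ |X h|} : ℝ) * δ ^ 2
      ≤ ∑ h ∈ twoToOneFinset (2 * m), X h ^ 2 := by
    rw [← nsmul_eq_mul, ← sum_const]
    refine (sum_le_sum fun h hh => ?_).trans
      (sum_le_sum_of_subset_of_nonneg (filter_subset _ _) fun h _ _ => sq_nonneg _)
    rw [← sq_abs (X h)]
    have := (mem_filter.1 hh).2
    gcongr
  change (ProbabilityTheory.uniformOn (twoToOneMaps (2 * m))).real {h | δ ≤ |X h|} ≤ _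
  rw [hmeas]
  refine div_le_of_le_mul₀ (by positivity) (by positivity) ?_
  have hpow : ((2 * m : ℕ) : ℝ) ^ (-(3 / 16) : ℝ) = δ * δ ^ 2 := by
    rw [hδ, one_div, ← Real.rpow_neg hkr.le, ← Real.rpow_natCast, ← Real.rpow_mul hkr.le,
      ← Real.rpow_add hkr]
    norm_num
  have h2 := hcheb.trans hvar
  rw [hpow] at h2
  refine le_of_mul_le_mul_right (a := δ ^ 2) (h2.trans (le_of_eq ?_)) (by positivity)
  rw [show (9 : ℝ) / ((2 * m : ℕ) : ℝ) ^ (1 / 16 : ℝ) = 9 * δ by rw [hδ]; ring]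
  ring
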